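/- Let $N\ge 1$, let $\mathcal E_1,\dots,\mathcal E_N$ be real numbers with $\sum_{i}\mathcal E_i=0$, and let $A=-i\,\mathrm{diag}(\mathcal E_1,\dots,\mathcal E_N)$. Let $B=[b_{ij}]\in\mathfrak{su}(N)$ be a traceless skew-Hermitian $N\times N$ matrix, and let $\mathcal G_B$ be the graph with nodes $1,\dots,N$ and an arc $(i,j)$ whenever $b_{ij}\neq 0$. Assume that $\mathcal G_B$ is connected and that $A$ is regular in the following sense: the transitions $\mathcal E_j-\mathcal E_i$, taken over all ordered pairs $(i,j)$ with $i\neq j$, are nonzero and pairwise distinct, i.e. $\mathcal E_j-\mathcal E_i\neq\mathcal E_l-\mathcal E_k$ whenever $i\neq j$, $k\neq l$ and $(i,j)\neq(k,l)$. Then the control system $$\dot X(t)=\bigl(A+u(t)B\bigr)X(t),\qquad X(0)=I,\qquad X(t)\in SU(N),$$ is controllable: for every $\bar X\in SU(N)$ there are a time $T\ge 0$ and a piecewise constant input $u:[0,T]\to\mathbb R$ such that the corresponding (continuous, piecewise differentiable) solution satisfies $X(T)=\bar X$. -/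

import Mathlib

open scoped Matrix Topology

namespace QuantumControl

/-- The real vector space (Lie algebra) `𝔰𝔲(N)` of traceless skew-Hermitian `N × N` complex matrices. -/
def su (N : ℕ) : Submodule ℝ (Matrix (Fin N) (Fin N) ℂ) where
  carrier := {X | Xᴴ = -X ∧ X.trace = 0}
  zero_mem' := by simp
  add_mem' := by
    rintro X Y ⟨hX, hX'⟩ ⟨hY, hY'⟩
    refine ⟨?_, ?_⟩
    · rw [Matrix.conjTranspose_add, hX, hY, neg_add]
    · rw [Matrix.trace_add, hX', hY', add_zero]
  smul_mem' := by
    rintro c X ⟨hX, hX'⟩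
    refine ⟨?_, ?_⟩
    · rw [Matrix.conjTranspose_smul, hX, star_trivial, smul_neg]
    · rw [Matrix.trace_smul, hX', smul_zero]

/-- The diagonal drift `A = -i H₀`, where `H₀ = diag(E₁, …, E_N)` is the free Hamiltonian
with energy levels `E` (in units with `ℏ = 1`). -/
noncomputable def drift {N : ℕ} (E : Fin N → ℝ) : Matrix (Fin N) (Fin N) ℂ :=
  Matrix.diagonal fun j => -Complex.I * (E j : ℂ)

/-- The diagonal drift with energy levels `E` is regular: the energy transitions `E j - E i`,
over all ordered pairs of different indices (that is, the values of all the roots), are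
nonzero and pairwise distinct. -/
def IsRegularDrift {N : ℕ} (E : Fin N → ℝ) : Prop :=
  (∀ i j, i ≠ j → E j - E i ≠ 0) ∧
    ∀ i j k l, i ≠ j → k ≠ l → (i, j) ≠ (k, l) → E j - E i ≠ E l - E k

/-- The graph of a square matrix `B`: there is an arc from `i` to `j` whenever `B i j ≠ 0`
(loops included). -/
def matrixGraph {N : ℕ} (B : Matrix (Fin N) (Fin N) ℂ) : Digraph (Fin N) where
  Adj i j := B i j ≠ 0

/-- The graph of `B` is connected, as an undirected graph. For skew-Hermitian `B` this is the
same as strong connectedness, because then `B i j ≠ 0` if and only if `B j i ≠ 0`. -/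
def GraphConnected {N : ℕ} (B : Matrix (Fin N) (Fin N) ℂ) : Prop :=
  (matrixGraph B).toSimpleGraphInclusive.Connected

/-- `X` is an integral curve on `[0, T]`, in `SU(N)` and starting at the identity, of
`X'(t) = (A + u(t) B) X(t)`, for the input `u` that is piecewise constant on `[0, T]`: away from
a finite set of switching times `u` is locally constant and the equation holds, and `X` is
continuous on all of `[0, T]`. -/
def IsTrajectory {N : ℕ} (A B : Matrix (Fin N) (Fin N) ℂ) (T : ℝ) (u : ℝ → ℝ)
    (X : ℝ → Matrix (Fin N) (Fin N) ℂ) : Prop :=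
  ContinuousOn X (Set.Icc 0 T) ∧
    (∀ t ∈ Set.Icc 0 T, X t ∈ Matrix.specialUnitaryGroup (Fin N) ℂ) ∧
    X 0 = 1 ∧
    ∃ S : Finset ℝ, ∀ t ∈ Set.Ioo 0 T, t ∉ S →
      (∀ᶠ s in 𝓝 t, u s = u t) ∧ HasDerivAt X ((A + u t • B) * X t) t

/-- The set of all points of `SU(N)` that are reached from the identity, in some time `T ≥ 0`,
by means of some piecewise constant real input. -/
def reachableSet {N : ℕ} (A B : Matrix (Fin N) (Fin N) ℂ) :
    Set (Matrix.specialUnitaryGroup (Fin N) ℂ) :=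
  {Y | ∃ T : ℝ, 0 ≤ T ∧ ∃ (u : ℝ → ℝ) (X : ℝ → Matrix (Fin N) (Fin N) ℂ),
    IsTrajectory A B T u X ∧ X T = Y}

/-- The system `X'(t) = (A + u(t) B) X(t)`, `X(0) = I`, on `SU(N)` is (globally) controllable. -/
def Controllable {N : ℕ} (A B : Matrix (Fin N) (Fin N) ℂ) : Prop :=
  reachableSet A B = Set.univ

end QuantumControl

/-! Lie algebra. Bracketing with the drift `A` multiplies entry `(k, l)` by `-i (E k - E l)`, so a
real polynomial in `(ad A)²` multiplies it by a real function of `(E k - E l)²`. Regularity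
separates these squares for different pairs `{k, l}`, so such a polynomial cuts out of `B` its part
at `(i, j)` and `(j, i)`. One more bracket with `A` rotates this part by a quarter turn and gives
all `z E_{ij} - z̄ E_{ji}` on an arc. Brackets along paths reach every pair, and brackets within a
pair give the diagonal (`su_le_of_regular_of_connected`).

Density. Only positive times are available, but in a compact group a semigroup is dense as soon as
the group it generates is. The closure of that group has a tangent space that is a Lie algebra
containing `A` and `B`, hence 𝔰𝔲(N), and so it is SU(N) (`dense_flowMonoid`).

Exact reachability. A dense semigroup with an interior point is the whole group
(`eq_top_of_dense_of_mem_nhds`). To find one, take a smooth family in the semigroup whose velocity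
space `V` is maximal. Appending the drift flow cannot enlarge `V`, so by density `V` contains every
conjugate of `A`, and these span at least 𝔰𝔲(N) (`exists_isVelocitySpace_su`). The open mapping
property then gives an interior point (`IsVelocitySpace.mem_nhds`). -/

namespace QuantumControl

open scoped Matrix.Norms.L2Operator
open Filter NormedSpace

variable {N : ℕ}

/-! ### Exponentials and the compact group SU(N) -/

/-- The determinant of the exponential of `i H`, for a Hermitian matrix `H`. -/
theorem det_exp_I_smul {H : Matrix (Fin N) (Fin N) ℂ} (hH : H.IsHermitian) :
    (exp (Complex.I • H)).det = Complex.exp (Complex.I * H.trace) := by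
  have hspec := hH.spectral_theorem
  set U := hH.eigenvectorUnitary
  set d : Fin N → ℂ := RCLike.ofReal ∘ hH.eigenvalues with hd
  rw [Unitary.conjStarAlgAut_apply] at hspec
  have hUU : (U : Matrix (Fin N) (Fin N) ℂ) * star (U : Matrix (Fin N) (Fin N) ℂ) = 1 :=
    Unitary.mul_star_self_of_mem U.2
  have hUU' : star (U : Matrix (Fin N) (Fin N) ℂ) * (U : Matrix (Fin N) (Fin N) ℂ) = 1 :=
    Unitary.star_mul_self_of_mem U.2
  have hinv : (U : Matrix (Fin N) (Fin N) ℂ)⁻¹ = star (U : Matrix (Fin N) (Fin N) ℂ) :=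
    Matrix.inv_eq_right_inv hUU
  have htr : H.trace = ∑ i, d i := by
    rw [hspec, Matrix.trace_mul_cycle, hUU', one_mul, Matrix.trace_diagonal]
  have hexp : exp (Complex.I • H) = U * exp (Matrix.diagonal (Complex.I • d)) *
      (U : Matrix (Fin N) (Fin N) ℂ)⁻¹ := by
    rw [← Matrix.exp_conj _ _ (IsUnit.of_mul_eq_one _ hUU), hinv]
    conv_lhs => rw [hspec]
    rw [Matrix.diagonal_smul, Matrix.mul_smul, Matrix.smul_mul]
  rw [hexp, Matrix.det_conj (IsUnit.of_mul_eq_one _ hUU), Matrix.exp_diagonal, Matrix.det_diagonal,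
    htr, Finset.mul_sum, Complex.exp_sum]
  refine Finset.prod_congr rfl fun i _ => ?_
  rw [Pi.coe_exp, Complex.exp_eq_exp_ℂ]
  rfl

theorem isHermitian_neg_I_smul {X : Matrix (Fin N) (Fin N) ℂ} (hX : Xᴴ = -X) :
    (-Complex.I • X).IsHermitian := by
  rw [Matrix.IsHermitian, Matrix.conjTranspose_smul, hX]
  simp

theorem det_exp_of_conjTranspose_eq_neg {X : Matrix (Fin N) (Fin N) ℂ} (hX : Xᴴ = -X) :
    (exp X).det = Complex.exp X.trace := by
  have h := det_exp_I_smul (isHermitian_neg_I_smul hX)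
  rw [smul_smul, Matrix.trace_smul, smul_eq_mul, ← mul_assoc] at h
  simpa using h

theorem exp_mem_unitaryGroup {X : Matrix (Fin N) (Fin N) ℂ} (hX : Xᴴ = -X) :
    exp X ∈ Matrix.unitaryGroup (Fin N) ℂ := by
  let _ : NormedAlgebra ℚ (Matrix (Fin N) (Fin N) ℂ) := NormedAlgebra.restrictScalars ℚ ℂ _
  exact exp_mem_unitary_of_mem_skewAdjoint (skewAdjoint.mem_iff.2 hX)

theorem exp_mem_specialUnitaryGroup {X : Matrix (Fin N) (Fin N) ℂ} (hX : X ∈ su N) :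
    exp X ∈ Matrix.specialUnitaryGroup (Fin N) ℂ := by
  refine Matrix.mem_specialUnitaryGroup_iff.2 ⟨exp_mem_unitaryGroup hX.1, ?_⟩
  rw [det_exp_of_conjTranspose_eq_neg hX.1, hX.2, Complex.exp_zero]

/-- The exponential map from `𝔰𝔲(N)` to `SU(N)`. -/
noncomputable def expSU (X : su N) : Matrix.specialUnitaryGroup (Fin N) ℂ :=
  ⟨exp (X : Matrix (Fin N) (Fin N) ℂ), exp_mem_specialUnitaryGroup X.2⟩

@[simp]
theorem coe_expSU (X : su N) : (expSU X : Matrix (Fin N) (Fin N) ℂ) = exp (X : Matrix _ _ ℂ) :=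
  rfl

theorem expSU_add_smul (X : su N) (s t : ℝ) :
    expSU ((s + t) • X) = expSU (s • X) * expSU (t • X) := by
  ext1
  simp only [coe_expSU, Submodule.coe_smul, Submonoid.coe_mul, add_smul]
  exact Matrix.exp_add_of_commute _ _ (((Commute.refl _).smul_left s).smul_right t)

theorem expSU_zero : expSU (0 : su N) = 1 := by
  ext1
  simp

theorem coe_inv_specialUnitaryGroup (U : Matrix.specialUnitaryGroup (Fin N) ℂ) :
    ((U⁻¹ : Matrix.specialUnitaryGroup (Fin N) ℂ) : Matrix (Fin N) (Fin N) ℂ) =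
      (U : Matrix (Fin N) (Fin N) ℂ)ᴴ :=
  rfl

instance : IsTopologicalGroup (Matrix.specialUnitaryGroup (Fin N) ℂ) where
  continuous_inv := (continuous_star.comp continuous_subtype_val).subtype_mk _

theorem isClosed_specialUnitaryGroup :
    IsClosed (Matrix.specialUnitaryGroup (Fin N) ℂ : Set (Matrix (Fin N) (Fin N) ℂ)) := by
  have h : (Matrix.specialUnitaryGroup (Fin N) ℂ : Set (Matrix (Fin N) (Fin N) ℂ)) =
      {U | U * star U = 1} ∩ {U | U.det = 1} := by
    ext U
    simp [Matrix.mem_specialUnitaryGroup_iff, Matrix.mem_unitaryGroup_iff]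
  rw [h]
  exact (isClosed_eq (by fun_prop) continuous_const).inter
    (isClosed_eq (Continuous.matrix_det continuous_id) continuous_const)

theorem norm_le_one_of_mem_unitaryGroup {U : Matrix (Fin N) (Fin N) ℂ}
    (hU : U ∈ Matrix.unitaryGroup (Fin N) ℂ) : ‖U‖ ≤ 1 := by
  rcases subsingleton_or_nontrivial (Matrix (Fin N) (Fin N) ℂ) with h | h
  · rw [Subsingleton.elim U 0, norm_zero]
    exact zero_le_one
  · exact (CStarRing.norm_of_mem_unitary hU).le

instance : CompactSpace (Matrix.specialUnitaryGroup (Fin N) ℂ) := by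
  refine isCompact_iff_compactSpace.1 (Metric.isCompact_of_isClosed_isBounded
    isClosed_specialUnitaryGroup ?_)
  exact (Metric.isBounded_closedBall (x := 0) (r := 1)).subset fun U hU => by
    simpa using norm_le_one_of_mem_unitaryGroup (Matrix.specialUnitaryGroup_le_unitaryGroup hU)

/-- Every unitary matrix is the exponential of `i` times a Hermitian matrix. -/
theorem exists_exp_I_smul_eq {U : Matrix (Fin N) (Fin N) ℂ}
    (hU : U ∈ Matrix.unitaryGroup (Fin N) ℂ) :
    ∃ H : Matrix (Fin N) (Fin N) ℂ, H.IsHermitian ∧ exp (Complex.I • H) = U := by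
  have hU' : U ∈ unitary (Matrix (Fin N) (Fin N) ℂ) := hU
  have hn : IsStarNormal U := ⟨by
    rw [Commute, SemiconjBy, Unitary.star_mul_self_of_mem hU', Unitary.mul_star_self_of_mem hU']⟩
  -- The jump of `arg` is harmless: the spectrum is finite, so every function is continuous on it.
  refine ⟨cfc (fun z : ℂ => (z.arg : ℂ)) U, IsSelfAdjoint.cfc_arg U, ?_⟩
  have hc (f : ℂ → ℂ) : ContinuousOn f (spectrum ℂ U) := U.finite_spectrum.continuousOn f
  rw [← CFC.exp_eq_normedSpace_exp (𝕜 := ℂ), ← cfc_comp_smul (hf := Continuous.continuousOn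
    (by fun_prop)), ← cfc_comp' (hf := hc _) (hg := Continuous.continuousOn (by fun_prop))]
  conv_rhs => rw [← cfc_id' ℂ U]
  refine cfc_congr fun y hy ↦ ?_
  have hy₁ : ‖y‖ = 1 := spectrum.norm_eq_one_of_unitary hU' hy
  have : Complex.I * y.arg = Complex.log y :=
    Complex.ext (by simp [Complex.log_re, hy₁]) (by simp [Complex.log_im])
  have hy₀ : y ≠ 0 := by
    rintro rfl
    simp at hy₁
  simpa [← Complex.exp_eq_exp_ℂ, this] using Complex.exp_log hy₀

/-- Every element of `SU(N)` is a product of two exponentials of elements of `𝔰𝔲(N)`. -/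
theorem exists_eq_expSU_mul_expSU [NeZero N] (U : Matrix.specialUnitaryGroup (Fin N) ℂ) :
    ∃ X Y : su N, U = expSU X * expSU Y := by
  obtain ⟨hU, hdet⟩ := Matrix.mem_specialUnitaryGroup_iff.1 U.2
  obtain ⟨H, hH, hexp⟩ := exists_exp_I_smul_eq hU
  rw [← hexp, det_exp_I_smul hH, Complex.exp_eq_one_iff] at hdet
  obtain ⟨n, hn⟩ := hdet
  have hN : (N : ℂ) ≠ 0 := Nat.cast_ne_zero.2 (NeZero.ne N)
  have htr : H.trace = n * (2 * Real.pi) := by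
    have : Complex.I * H.trace = Complex.I * (n * (2 * Real.pi)) := by
      rw [hn]
      ring
    exact mul_left_cancel₀ Complex.I_ne_zero this
  -- The trace of `H` is only a multiple of `2π`. Subtracting the scalar `c` makes it zero; the lost
  -- factor `exp (i c)` is restored by a diagonal matrix whose first entry is shifted by `2πi n`,
  -- which its trace needs and its exponential ignores.
  set c : ℝ := n * (2 * Real.pi) / N with hc
  have hcN : (c : ℂ) * N = n * (2 * Real.pi) := by
    rw [hc]
    push_cast
    field_simp
  have hX : Complex.I • (H - (c : ℂ) • (1 : Matrix (Fin N) (Fin N) ℂ)) ∈ su N := by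
    refine ⟨?_, ?_⟩
    · rw [Matrix.conjTranspose_smul, Matrix.conjTranspose_sub, hH.eq, Matrix.conjTranspose_smul]
      simp
    · rw [Matrix.trace_smul, Matrix.trace_sub, Matrix.trace_smul, htr]
      simp [hcN]
  have hY : Matrix.diagonal (fun j : Fin N => Complex.I * c -
      if j = 0 then n * (2 * Real.pi * Complex.I) else 0) ∈ su N := by
    refine ⟨?_, ?_⟩
    · rw [Matrix.diagonal_conjTranspose, Matrix.diagonal_neg]
      congr 1
      ext j
      by_cases hj : j = 0
      · simp [hj]
        ring
      · simp [hj]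
    · rw [Matrix.trace_diagonal, Finset.sum_sub_distrib]
      simp only [Finset.sum_const, Finset.card_univ, Fintype.card_fin, nsmul_eq_mul,
        Finset.sum_ite_eq', Finset.mem_univ, if_true]
      linear_combination Complex.I * hcN
  refine ⟨⟨_, hX⟩, ⟨_, hY⟩, ?_⟩
  ext1
  rw [Submonoid.coe_mul, coe_expSU, coe_expSU, ← hexp]
  have hexpY : exp (Matrix.diagonal (fun j : Fin N => Complex.I * c -
      if j = 0 then n * (2 * Real.pi * Complex.I) else 0)) =
      exp ((Complex.I * c) • (1 : Matrix (Fin N) (Fin N) ℂ)) := by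
    rw [← Matrix.diagonal_one, ← Matrix.diagonal_smul, Matrix.exp_diagonal, Matrix.exp_diagonal]
    congr 1
    ext j
    rw [Pi.coe_exp, Pi.coe_exp, ← Complex.exp_eq_exp_ℂ]
    by_cases hj : j = 0
    · simp [hj, Complex.exp_sub, Complex.exp_int_mul_two_pi_mul_I]
    · simp [hj]
  rw [hexpY, ← Matrix.exp_add_of_commute _ _ ((Commute.one_right _).smul_right _)]
  simp only [smul_sub, smul_smul, sub_add_cancel]

/-! ### Generating 𝔰𝔲(N) by brackets -/

/-- The skew-Hermitian matrix `z E_{ij} - z̄ E_{ji}`. -/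
noncomputable def skewSingle (i j : Fin N) (z : ℂ) : Matrix (Fin N) (Fin N) ℂ :=
  Matrix.single i j z - Matrix.single j i (star z)

theorem skewSingle_add (i j : Fin N) (z w : ℂ) :
    skewSingle i j (z + w) = skewSingle i j z + skewSingle i j w := by
  simp only [skewSingle, Matrix.single_add, star_add]
  abel

theorem skewSingle_real_smul (i j : Fin N) (r : ℝ) (z : ℂ) :
    skewSingle i j (r * z) = r • skewSingle i j z := by
  simp only [skewSingle, smul_sub, Matrix.smul_single]
  simp

theorem skewSingle_mem_su {i j : Fin N} (hij : i ≠ j) (z : ℂ) : skewSingle i j z ∈ su N := by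
  refine ⟨?_, ?_⟩
  · simp [skewSingle, Matrix.conjTranspose_single]
  · simp [skewSingle, Matrix.trace_single_eq_of_ne, hij, hij.symm]

theorem lie_skewSingle_skewSingle {i j k : Fin N} (hij : i ≠ j) (hjk : j ≠ k) (hik : i ≠ k)
    (z w : ℂ) : ⁅skewSingle i j z, skewSingle j k w⁆ = skewSingle i k (z * w) := by
  simp [skewSingle, Ring.lie_def, mul_sub, sub_mul, hij, hjk, hik, hij.symm, hjk.symm, hik.symm,
    mul_comm]

theorem lie_skewSingle_self {i j : Fin N} (hij : i ≠ j) (a : ℝ) :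
    ⁅skewSingle i j 1, skewSingle i j (Complex.I * a)⁆ =
      Matrix.single i i (2 * (Complex.I * a)) - Matrix.single j j (2 * (Complex.I * a)) := by
  simp [skewSingle, Ring.lie_def, mul_sub, sub_mul, hij, hij.symm, two_mul, Matrix.single_add]
  simp only [← Matrix.single_neg]
  abel

theorem lie_drift_apply (E : Fin N → ℝ) (X : Matrix (Fin N) (Fin N) ℂ) (k l : Fin N) :
    ⁅drift E, X⁆ k l = -Complex.I * (E k - E l) * X k l := by
  rw [Ring.lie_def, Matrix.sub_apply, drift, Matrix.diagonal_mul, Matrix.mul_diagonal]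
  ring

theorem lie_drift_single (E : Fin N → ℝ) (i j : Fin N) (z : ℂ) :
    ⁅drift E, Matrix.single i j z⁆ = Matrix.single i j (-Complex.I * (E i - E j) * z) := by
  ext k l
  rw [lie_drift_apply, Matrix.single_apply, Matrix.single_apply]
  by_cases h : i = k ∧ j = l
  · rw [if_pos h, if_pos h, h.1, h.2]
  · rw [if_neg h, if_neg h, mul_zero]

theorem lie_drift_skewSingle (E : Fin N → ℝ) (i j : Fin N) (z : ℂ) :
    ⁅drift E, skewSingle i j z⁆ = skewSingle i j (-Complex.I * (E i - E j) * z) := by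
  have hsub (X Y : Matrix (Fin N) (Fin N) ℂ) : ⁅drift E, X - Y⁆ = ⁅drift E, X⁆ - ⁅drift E, Y⁆ := by
    simp only [Ring.lie_def, mul_sub, sub_mul]
    abel
  rw [skewSingle, skewSingle, hsub, lie_drift_single, lie_drift_single]
  congr 2
  simp only [star_mul', star_neg, star_sub, Complex.star_def, Complex.conj_I, Complex.conj_ofReal]
  ring

/-- A real subspace that contains all `z E_{ij} - z̄ E_{ji}` with `i ≠ j`, and the brackets of
these, contains `𝔰𝔲(N)`. -/
theorem su_le_of_skewSingle_mem {V : Submodule ℝ (Matrix (Fin N) (Fin N) ℂ)}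
    (h : ∀ i j, i ≠ j → ∀ z, skewSingle i j z ∈ V)
    (hlie : ∀ i j, i ≠ j → ∀ z w, ⁅skewSingle i j z, skewSingle i j w⁆ ∈ V) : su N ≤ V := by
  intro X hX
  rcases Nat.eq_zero_or_pos N with rfl | hN
  · rw [Subsingleton.elim X 0]
    exact V.zero_mem
  have : NeZero N := ⟨hN.ne'⟩
  have hsum : ∑ i, ∑ j, skewSingle i j (X i j) = (2 : ℝ) • X := by
    simp only [skewSingle, Finset.sum_sub_distrib]
    have h1 : ∑ i, ∑ j, Matrix.single j i (star (X i j)) = Xᴴ := by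
      rw [Finset.sum_comm]
      conv_rhs => rw [Matrix.matrix_eq_sum_single Xᴴ]
      rfl
    rw [h1, ← Matrix.matrix_eq_sum_single, hX.1, two_smul, sub_neg_eq_add]
  -- This sum vanishes because the trace does. Subtracting it turns each diagonal term into a
  -- multiple of `E_{ii} - E_{00}`, which is a bracket.
  have htr : ∑ i, ∑ j, (if i = j then Matrix.single 0 0 (2 * X i i) else 0 :
      Matrix (Fin N) (Fin N) ℂ) = 0 := by
    simp only [Finset.sum_ite_eq, Finset.mem_univ, if_true]
    have := map_sum (Matrix.singleAddMonoidHom (α := ℂ) (0 : Fin N) (0 : Fin N))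
      (fun i => 2 * X i i) Finset.univ
    simp only [Matrix.singleAddMonoidHom_apply] at this
    rw [← this, ← Finset.mul_sum]
    have h0 : ∑ i, X i i = 0 := hX.2
    rw [h0, mul_zero, Matrix.single_zero]
  have key : (2 : ℝ) • X ∈ V := by
    rw [← hsum, ← sub_zero (∑ i, ∑ j, skewSingle i j (X i j)), ← htr, ← Finset.sum_sub_distrib]
    refine V.sum_mem fun i _ => ?_
    rw [← Finset.sum_sub_distrib]
    refine V.sum_mem fun j _ => ?_
    by_cases hij : i = j
    · subst hij
      have hstar : star (X i i) = -X i i := by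
        have := congrFun (congrFun hX.1 i) i
        simpa using this
      obtain ⟨a, ha⟩ : ∃ a : ℝ, X i i = Complex.I * a := by
        refine ⟨(X i i).im, ?_⟩
        have hre := congrArg Complex.re hstar
        simp only [Complex.star_def, Complex.conj_re, Complex.neg_re] at hre
        apply Complex.ext
        · simp
          linarith
        · simp
      have hs : skewSingle i i (X i i) = Matrix.single i i (2 * X i i) := by
        rw [skewSingle, hstar, ← Matrix.single_neg, sub_neg_eq_add, two_mul, Matrix.single_add]
      rw [if_pos rfl, hs, ha]
      by_cases hi : i = 0
      · rw [hi, sub_self]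
        exact V.zero_mem
      · rw [← lie_skewSingle_self hi]
        exact hlie i 0 hi _ _
    · rw [if_neg hij, sub_zero]
      exact h i j hij _
  have := V.smul_mem (2 : ℝ)⁻¹ key
  rwa [smul_smul, inv_mul_cancel₀ two_ne_zero, one_smul] at this

/-- A real subspace invariant under brackets with `𝔰𝔲(N)` that contains a diagonal drift with
distinct energy levels contains `𝔰𝔲(N)`. -/
theorem su_le_of_lie_su_mem {E : Fin N → ℝ} (hE : ∀ i j, i ≠ j → E j - E i ≠ 0)
    {V : Submodule ℝ (Matrix (Fin N) (Fin N) ℂ)} (hV : drift E ∈ V)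
    (hlie : ∀ X ∈ V, ∀ Y ∈ su N, ⁅X, Y⁆ ∈ V) : su N ≤ V := by
  have h : ∀ i j, i ≠ j → ∀ z, skewSingle i j z ∈ V := by
    intro i j hij z
    have := hlie _ hV _ (skewSingle_mem_su hij ((-Complex.I * (E i - E j))⁻¹ * z))
    rwa [lie_drift_skewSingle, mul_inv_cancel_left₀] at this
    refine mul_ne_zero (neg_ne_zero.2 Complex.I_ne_zero) ?_
    exact_mod_cast hE j i hij.symm
  exact su_le_of_skewSingle_mem h fun i j hij z w => hlie _ (h i j hij z) _ (skewSingle_mem_su hij w)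

/-- Each factor is the action of `(ad A)² + (E p.1 - E p.2)²` on the entry `(k, l)`; it kills the
entries at `p` and at its transpose. The product serves as a projection, up to scale, onto the
entries that survive. -/
theorem mul_prod_mem_of_lie_drift_mem {E : Fin N → ℝ}
    {V : Submodule ℝ (Matrix (Fin N) (Fin N) ℂ)} (hV : ∀ X ∈ V, ⁅drift E, X⁆ ∈ V)
    {X : Matrix (Fin N) (Fin N) ℂ} (hX : X ∈ V) (s : Finset (Fin N × Fin N)) :
    (Matrix.of fun k l => ((∏ p ∈ s, ((E p.1 - E p.2) ^ 2 - (E k - E l) ^ 2) : ℝ) : ℂ) * X k l)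
      ∈ V := by
  induction s using Finset.induction_on with
  | empty =>
    convert hX using 1
    ext k l
    simp
  | insert p s hp ih =>
    convert V.add_mem (hV _ (hV _ ih)) (V.smul_mem ((E p.1 - E p.2) ^ 2) ih) using 1
    ext k l
    rw [Matrix.add_apply, lie_drift_apply, lie_drift_apply, Matrix.smul_apply]
    simp only [Matrix.of_apply, Complex.real_smul, Finset.prod_insert hp]
    push_cast
    linear_combination (-(E k - E l : ℂ) ^ 2 *
      (∏ x ∈ s, ((E x.1 - E x.2 : ℂ) ^ 2 - (E k - E l) ^ 2)) * X k l) * Complex.I_sq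

/-- For a regular drift, a real subspace that is invariant under the bracket with the drift and
contains `B` contains the components of `B`. -/
theorem skewSingle_mem_of_lie_drift_mem {E : Fin N → ℝ} (hE : IsRegularDrift E)
    {V : Submodule ℝ (Matrix (Fin N) (Fin N) ℂ)} (hV : ∀ X ∈ V, ⁅drift E, X⁆ ∈ V)
    {B : Matrix (Fin N) (Fin N) ℂ} (hB : Bᴴ = -B) (hBV : B ∈ V) {i j : Fin N} (hij : i ≠ j)
    (hb : B i j ≠ 0) (z : ℂ) : skewSingle i j z ∈ V := by
  classical
  -- The diagonal pairs belong to `s`, so the diagonal of `B` is removed too. The scale `r` left on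
  -- `(i, j)` is nonzero by regularity.
  set s : Finset (Fin N × Fin N) := Finset.univ.filter fun p => p ≠ (i, j) ∧ p ≠ (j, i) with hs
  set r : ℝ := ∏ p ∈ s, ((E p.1 - E p.2) ^ 2 - (E i - E j) ^ 2) with hr
  have hr0 : r ≠ 0 := by
    refine Finset.prod_ne_zero_iff.2 fun p hp h => ?_
    obtain ⟨k, l⟩ := p
    simp only [hs, Finset.mem_filter, Finset.mem_univ, true_and] at hp
    rw [sub_eq_zero, sq_eq_sq_iff_eq_or_eq_neg] at h
    have hij' := hE.1 j i hij.symm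
    by_cases hkl : k = l
    · subst hkl
      rcases h with h | h <;> simp only [sub_self] at h
      · exact hij' h.symm
      · exact hij' (by linarith)
    · rcases h with h | h
      · exact hE.2 l k j i (Ne.symm hkl) hij.symm (fun e => hp.1 (by simp_all)) h
      · refine hE.2 l k i j (Ne.symm hkl) hij (fun e => hp.2 (by simp_all)) ?_
        rw [h]
        ring
  have hji : B j i = -star (B i j) := by
    have := congrFun (congrFun hB j) i
    rw [Matrix.conjTranspose_apply, Matrix.neg_apply] at this
    rw [this, neg_neg]
  have h1 : skewSingle i j (r * B i j) ∈ V := by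
    convert mul_prod_mem_of_lie_drift_mem hV hBV s using 1
    ext k l
    simp only [skewSingle, Matrix.sub_apply, Matrix.single_apply, Matrix.of_apply]
    by_cases h : i = k ∧ j = l
    · obtain ⟨rfl, rfl⟩ := h
      simp [hij.symm, hr]
    · by_cases h' : j = k ∧ i = l
      · obtain ⟨rfl, rfl⟩ := h'
        rw [if_neg h, if_pos ⟨rfl, rfl⟩, hji, hr, zero_sub]
        simp only [star_mul', Complex.star_def, Complex.conj_ofReal, mul_neg, neg_inj]
        rw [← neg_sub (E i) (E j), neg_sq]
      · have hmem : (k, l) ∈ s := by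
          simp only [hs, Finset.mem_filter, Finset.mem_univ, true_and, ne_eq, Prod.mk.injEq]
          exact ⟨fun e => h ⟨e.1.symm, e.2.symm⟩, fun e => h' ⟨e.1.symm, e.2.symm⟩⟩
        rw [if_neg h, if_neg h', Finset.prod_eq_zero hmem (sub_self _)]
        simp
  have h2 := hV _ h1
  rw [lie_drift_skewSingle] at h2
  have hω : E i - E j ≠ 0 := hE.1 j i hij.symm
  -- Real coordinates of `z` in the basis of `ℂ` formed by `r * B i j` and its quarter turn.
  have hz : z = ((z / B i j).re / r : ℝ) * (r * B i j) +
      (-((z / B i j).im / (r * (E i - E j))) : ℝ) *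
        (-Complex.I * (E i - E j) * (r * B i j)) := by
    have h3 := Complex.re_add_im (z / B i j)
    have h4 : z = z / B i j * B i j := (div_mul_cancel₀ _ hb).symm
    have hrc : (r : ℂ) ≠ 0 := Complex.ofReal_ne_zero.2 hr0
    have hωc : (E i - E j : ℂ) ≠ 0 := by exact_mod_cast hω
    conv_lhs => rw [h4, ← h3]
    push_cast
    field_simp
  rw [hz, skewSingle_add, skewSingle_real_smul _ _ _ (r * B i j),
    skewSingle_real_smul _ _ _ (-Complex.I * (E i - E j) * (r * B i j))]
  exact V.add_mem (V.smul_mem _ h1) (V.smul_mem _ h2)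

/-- A regular drift and a skew-Hermitian matrix with a connected graph generate a Lie algebra
that contains `𝔰𝔲(N)`. -/
theorem su_le_of_regular_of_connected {E : Fin N → ℝ} (hE : IsRegularDrift E)
    {B : Matrix (Fin N) (Fin N) ℂ} (hB : Bᴴ = -B) (hconn : GraphConnected B)
    {V : Submodule ℝ (Matrix (Fin N) (Fin N) ℂ)} (hV : ∀ X ∈ V, ∀ Y ∈ V, ⁅X, Y⁆ ∈ V)
    (hEV : drift E ∈ V) (hBV : B ∈ V) : su N ≤ V := by
  have hadj : ∀ i j, (matrixGraph B).toSimpleGraphInclusive.Adj i j →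
      ∀ z, skewSingle i j z ∈ V := by
    intro i j h z
    have hij : i ≠ j := h.ne
    refine skewSingle_mem_of_lie_drift_mem hE (fun X hX => hV _ hEV _ hX) hB hBV hij ?_ z
    have hor : B i j ≠ 0 ∨ B j i ≠ 0 := by
      simpa [Digraph.toSimpleGraphInclusive, matrixGraph, hij] using h
    rcases hor with h | h
    · exact h
    · intro h0
      have := congrFun (congrFun hB j) i
      rw [Matrix.conjTranspose_apply, Matrix.neg_apply, h0, star_zero] at this
      exact h (neg_eq_zero.1 this.symm)
  have hwalk : ∀ i j, (matrixGraph B).toSimpleGraphInclusive.Walk i j →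
      i ≠ j → ∀ z, skewSingle i j z ∈ V := by
    intro i j p
    induction p with
    | nil => exact fun h => absurd rfl h
    | @cons i k j hik p ih =>
      intro hij z
      by_cases hkj : k = j
      · subst hkj
        exact hadj _ _ hik z
      · rw [← one_mul z, ← lie_skewSingle_skewSingle hik.ne hkj hij]
        exact hV _ (hadj _ _ hik 1) _ (ih hkj z)
  have hall : ∀ i j, i ≠ j → ∀ z, skewSingle i j z ∈ V := fun i j =>
    (hconn.preconnected i j).elim fun p => hwalk i j p
  exact su_le_of_skewSingle_mem hall fun i j hij z w => hV _ (hall i j hij z) _ (hall i j hij w)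

/-! ### Closed subgroups and their tangent spaces -/

theorem mem_of_hasDerivAt_of_forall_mem {V : Submodule ℝ (Matrix (Fin N) (Fin N) ℂ)}
    {c : ℝ → Matrix (Fin N) (Fin N) ℂ} {X : Matrix (Fin N) (Fin N) ℂ} {t : ℝ}
    (hc : HasDerivAt c X t) (hV : ∀ s, c s ∈ V) : X ∈ V := by
  have hclosed : IsClosed (V : Set (Matrix (Fin N) (Fin N) ℂ)) := V.closed_of_finiteDimensional
  exact hclosed.mem_of_tendsto hc.tendsto_slope_zero
    (Eventually.of_forall fun s => V.smul_mem _ (V.sub_mem (hV _) (hV _)))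

/-- Telescoping, where multiplication by a unitary matrix does not increase the norm. -/
theorem norm_pow_sub_pow_le_of_mem_unitaryGroup {U W : Matrix (Fin N) (Fin N) ℂ}
    (hU : U ∈ Matrix.unitaryGroup (Fin N) ℂ) (hW : W ∈ Matrix.unitaryGroup (Fin N) ℂ) (n : ℕ) :
    ‖U ^ n - W ^ n‖ ≤ n * ‖U - W‖ := by
  induction n with
  | zero => simp
  | succ n ih =>
    have h : U ^ (n + 1) - W ^ (n + 1) = U ^ n * (U - W) + (U ^ n - W ^ n) * W := by
      rw [pow_succ, pow_succ]
      noncomm_ring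
    have h1 : ‖U ^ n * (U - W)‖ ≤ ‖U - W‖ :=
      (norm_mul_le _ _).trans (mul_le_of_le_one_left (norm_nonneg _)
        (norm_le_one_of_mem_unitaryGroup (pow_mem hU n)))
    have h2 : ‖(U ^ n - W ^ n) * W‖ ≤ ‖U ^ n - W ^ n‖ :=
      (norm_mul_le _ _).trans (mul_le_of_le_one_right (norm_nonneg _)
        (norm_le_one_of_mem_unitaryGroup hW))
    rw [h]
    push_cast
    linarith [norm_add_le (U ^ n * (U - W)) ((U ^ n - W ^ n) * W)]

theorem coe_specialUnitaryGroup_mem_unitaryGroup (U : Matrix.specialUnitaryGroup (Fin N) ℂ) :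
    (U : Matrix (Fin N) (Fin N) ℂ) ∈ Matrix.unitaryGroup (Fin N) ℂ :=
  Matrix.specialUnitaryGroup_le_unitaryGroup U.2

theorem coe_mul_conjTranspose (U : Matrix.specialUnitaryGroup (Fin N) ℂ) :
    (U : Matrix (Fin N) (Fin N) ℂ) * (U : Matrix (Fin N) (Fin N) ℂ)ᴴ = 1 :=
  Matrix.mem_unitaryGroup_iff.1 (coe_specialUnitaryGroup_mem_unitaryGroup U)

theorem conjTranspose_mul_coe (U : Matrix.specialUnitaryGroup (Fin N) ℂ) :
    (U : Matrix (Fin N) (Fin N) ℂ)ᴴ * (U : Matrix (Fin N) (Fin N) ℂ) = 1 :=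
  Matrix.mem_unitaryGroup_iff'.1 (coe_specialUnitaryGroup_mem_unitaryGroup U)

theorem conj_mem_su (U : Matrix.specialUnitaryGroup (Fin N) ℂ) {X : Matrix (Fin N) (Fin N) ℂ}
    (hX : X ∈ su N) : (U : Matrix (Fin N) (Fin N) ℂ) * X * (U : Matrix (Fin N) (Fin N) ℂ)ᴴ ∈ su N := by
  refine ⟨?_, ?_⟩
  · rw [Matrix.conjTranspose_mul, Matrix.conjTranspose_mul, hX.1, Matrix.conjTranspose_conjTranspose]
    noncomm_ring
  · rw [Matrix.trace_mul_cycle, conjTranspose_mul_coe, one_mul, hX.2]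

theorem hasDerivAt_conj {c : ℝ → Matrix (Fin N) (Fin N) ℂ} {X Y : Matrix (Fin N) (Fin N) ℂ}
    (hX : Xᴴ = -X) (hc : HasDerivAt c X 0) (hc0 : c 0 = 1) :
    HasDerivAt (fun t => c t * Y * (c t)ᴴ) ⁅X, Y⁆ 0 := by
  have h := (hc.mul_const Y).mul hc.star
  have heq : ⁅X, Y⁆ = X * Y * star (c 0) + c 0 * Y * star X := by
    rw [Ring.lie_def, hc0, star_one, mul_one, one_mul, Matrix.star_eq_conjTranspose, hX]
    noncomm_ring
  rw [heq]
  exact h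

theorem hasDerivAt_exp_smul_zero (X : Matrix (Fin N) (Fin N) ℂ) :
    HasDerivAt (fun t : ℝ => exp (t • X)) X 0 := by
  simpa using hasDerivAt_exp_smul_const X (0 : ℝ)

/-- The tangent space at the identity of a subgroup of `SU(N)`: the velocities of the curves in
the subgroup that pass through the identity. -/
def tangentSpace (H : Subgroup (Matrix.specialUnitaryGroup (Fin N) ℂ)) :
    Submodule ℝ (Matrix (Fin N) (Fin N) ℂ) where
  carrier := {X | X ∈ su N ∧ ∃ γ : ℝ → Matrix.specialUnitaryGroup (Fin N) ℂ, (∀ t, γ t ∈ H) ∧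
    γ 0 = 1 ∧ HasDerivAt (fun t => (γ t : Matrix (Fin N) (Fin N) ℂ)) X 0}
  zero_mem' := ⟨(su N).zero_mem, fun _ => 1, fun _ => H.one_mem, rfl, hasDerivAt_const _ _⟩
  add_mem' := by
    rintro X Y ⟨hX, γ, hγ, hγ0, hγ'⟩ ⟨hY, δ, hδ, hδ0, hδ'⟩
    refine ⟨(su N).add_mem hX hY, fun t => γ t * δ t, fun t => H.mul_mem (hγ t) (hδ t), ?_, ?_⟩
    · simp only [hγ0, hδ0, one_mul]
    · have h := hγ'.mul hδ'
      simp only [hγ0, hδ0, Submonoid.coe_one, mul_one, one_mul] at h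
      exact h
  smul_mem' := by
    rintro r X ⟨hX, γ, hγ, hγ0, hγ'⟩
    refine ⟨(su N).smul_mem r hX, fun t => γ (r * t), fun t => hγ _, by simpa using hγ0, ?_⟩
    have h1 : HasDerivAt (fun t : ℝ => r * t) r 0 := by
      simpa using (hasDerivAt_id (0 : ℝ)).const_mul r
    have h2 : HasDerivAt (fun t => (γ t : Matrix (Fin N) (Fin N) ℂ)) X (r * 0) := by
      simpa using hγ'
    exact h2.scomp (0 : ℝ) h1

/-- The bracket is the derivative at `0` of the conjugates of `Y` by `γ s`. These are all tangent
vectors, and a subspace of finite dimension is closed. -/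
theorem lie_mem_tangentSpace {H : Subgroup (Matrix.specialUnitaryGroup (Fin N) ℂ)}
    {X Y : Matrix (Fin N) (Fin N) ℂ} (hX : X ∈ tangentSpace H) (hY : Y ∈ tangentSpace H) :
    ⁅X, Y⁆ ∈ tangentSpace H := by
  obtain ⟨hXsu, γ, hγ, hγ0, hγ'⟩ := hX
  obtain ⟨hYsu, δ, hδ, hδ0, hδ'⟩ := hY
  refine mem_of_hasDerivAt_of_forall_mem (hasDerivAt_conj hXsu.1 hγ' (by rw [hγ0]; rfl)) fun s => ?_
  refine ⟨conj_mem_su (γ s) hYsu, fun t => γ s * δ t * (γ s)⁻¹,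
    fun t => H.mul_mem (H.mul_mem (hγ s) (hδ t)) (H.inv_mem (hγ s)), ?_, ?_⟩
  · simp only [hδ0, mul_one, mul_inv_cancel]
  · exact (hδ'.const_mul (γ s : Matrix (Fin N) (Fin N) ℂ)).mul_const _

theorem mem_tangentSpace_of_expSU_mem {H : Subgroup (Matrix.specialUnitaryGroup (Fin N) ℂ)}
    {X : su N} (h : ∀ t : ℝ, expSU (t • X) ∈ H) :
    (X : Matrix (Fin N) (Fin N) ℂ) ∈ tangentSpace H :=
  ⟨X.2, fun t => expSU (t • X), h, by simp only [zero_smul, expSU_zero],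
    hasDerivAt_exp_smul_zero _⟩

/-- `exp X` is the limit of `γ (1 / n) ^ n`: the curves `γ` and `exp (t X)` agree to first order at
`0`, and taking the `n`-th power multiplies the error `o(1 / n)` by at most `n`. -/
theorem expSU_mem_of_mem_tangentSpace {H : Subgroup (Matrix.specialUnitaryGroup (Fin N) ℂ)}
    (hH : IsClosed (H : Set (Matrix.specialUnitaryGroup (Fin N) ℂ))) {X : su N}
    (hX : (X : Matrix (Fin N) (Fin N) ℂ) ∈ tangentSpace H) : expSU X ∈ H := by
  obtain ⟨-, γ, hγ, hγ0, hγ'⟩ := hX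
  set f : ℝ → Matrix (Fin N) (Fin N) ℂ := fun t => γ t - expSU (t • X) with hf
  have hf0 : f 0 = 0 := by rw [hf]; simp [hγ0, expSU_zero]
  have hf' : HasDerivAt f 0 0 := by
    simpa using! hγ'.sub (hasDerivAt_exp_smul_zero (X : Matrix (Fin N) (Fin N) ℂ))
  have htn : Tendsto (fun n : ℕ => ((n : ℝ) + 1)⁻¹) atTop (𝓝[≠] 0) := by
    refine tendsto_nhdsWithin_iff.2 ⟨?_, Eventually.of_forall fun n => ?_⟩
    · simpa using tendsto_one_div_add_atTop_nhds_zero_nat (𝕜 := ℝ)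
    · exact inv_ne_zero (by positivity)
  have hlim := (hf'.tendsto_slope_zero.comp htn).norm
  simp only [Function.comp_def, zero_add, hf0, sub_zero, inv_inv, norm_zero] at hlim
  have htend : Tendsto (fun n : ℕ => γ ((n : ℝ) + 1)⁻¹ ^ (n + 1)) atTop (𝓝 (expSU X)) := by
    rw [tendsto_subtype_rng, tendsto_iff_norm_sub_tendsto_zero]
    refine squeeze_zero (fun _ => norm_nonneg _) (fun n => ?_) hlim
    have hexp : expSU X = expSU (((n : ℝ) + 1)⁻¹ • X) ^ (n + 1) := by
      ext1
      rw [SubmonoidClass.coe_pow, coe_expSU, coe_expSU, ← Matrix.exp_nsmul, Submodule.coe_smul,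
        ← Nat.cast_smul_eq_nsmul ℝ, smul_smul]
      have : ((n : ℝ) + 1) ≠ 0 := by positivity
      push_cast
      rw [mul_inv_cancel₀ this, one_smul]
    rw [hexp, SubmonoidClass.coe_pow, SubmonoidClass.coe_pow]
    refine (norm_pow_sub_pow_le_of_mem_unitaryGroup (coe_specialUnitaryGroup_mem_unitaryGroup _)
      (coe_specialUnitaryGroup_mem_unitaryGroup _) _).trans (le_of_eq ?_)
    rw [norm_smul, Real.norm_of_nonneg (by positivity)]
    push_cast
    rfl
  exact hH.mem_of_tendsto htend (Eventually.of_forall fun n => H.pow_mem (hγ _) _)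

/-- A closed subgroup of `SU(N)` whose tangent space is `𝔰𝔲(N)` is the whole group. -/
theorem eq_top_of_su_le_tangentSpace [NeZero N]
    {H : Subgroup (Matrix.specialUnitaryGroup (Fin N) ℂ)}
    (hH : IsClosed (H : Set (Matrix.specialUnitaryGroup (Fin N) ℂ)))
    (h : su N ≤ tangentSpace H) : H = ⊤ := by
  refine (Subgroup.eq_top_iff' H).2 fun U => ?_
  obtain ⟨X, Y, rfl⟩ := exists_eq_expSU_mul_expSU U
  exact H.mul_mem (expSU_mem_of_mem_tangentSpace hH (h X.2))
    (expSU_mem_of_mem_tangentSpace hH (h Y.2))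

/-! ### Density of the positive-time semigroup -/

/-- The semigroup generated by the flows of `A + u B` in positive time. -/
noncomputable def flowMonoid (A B : su N) : Submonoid (Matrix.specialUnitaryGroup (Fin N) ℂ) :=
  Submonoid.closure {g | ∃ t : ℝ, 0 ≤ t ∧ ∃ u : ℝ, g = expSU (t • (A + u • B))}

theorem expSU_mem_flowMonoid (A B : su N) {t : ℝ} (ht : 0 ≤ t) (u : ℝ) :
    expSU (t • (A + u • B)) ∈ flowMonoid A B :=
  Submonoid.subset_closure ⟨t, ht, u, rfl⟩

theorem expSU_drift_mem_flowMonoid (A B : su N) {t : ℝ} (ht : 0 ≤ t) :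
    expSU (t • A) ∈ flowMonoid A B := by
  simpa using expSU_mem_flowMonoid A B ht 0

/-- If every real Lie algebra that contains `A` and `B` contains `𝔰𝔲(N)`, then the flows of
`A + u B` in positive time generate a dense semigroup. -/
theorem dense_flowMonoid [NeZero N] (A B : su N)
    (hAB : ∀ V : Submodule ℝ (Matrix (Fin N) (Fin N) ℂ), (∀ X ∈ V, ∀ Y ∈ V, ⁅X, Y⁆ ∈ V) →
      (A : Matrix (Fin N) (Fin N) ℂ) ∈ V → (B : Matrix (Fin N) (Fin N) ℂ) ∈ V → su N ≤ V) :
    Dense (flowMonoid A B : Set (Matrix.specialUnitaryGroup (Fin N) ℂ)) := by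
  -- Compactness of SU(N) enters here: inverses may be added without affecting density, which makes
  -- negative times available.
  rw [flowMonoid, dense_submonoidClosure_iff_subgroupClosure]
  set K := Subgroup.closure {g | ∃ t : ℝ, 0 ≤ t ∧ ∃ u : ℝ, g = expSU (t • (A + u • B))} with hK
  have hmem (u t : ℝ) : expSU (t • (A + u • B)) ∈ K.topologicalClosure := by
    refine K.le_topologicalClosure ?_
    rcases le_total 0 t with ht | ht
    · exact Subgroup.subset_closure ⟨t, ht, u, rfl⟩
    · have hinv : expSU (t • (A + u • B)) = (expSU ((-t) • (A + u • B)))⁻¹ := by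
        rw [eq_inv_iff_mul_eq_one, ← expSU_add_smul, add_neg_cancel, zero_smul, expSU_zero]
      rw [hinv]
      exact K.inv_mem (Subgroup.subset_closure ⟨-t, neg_nonneg.2 ht, u, rfl⟩)
  have hA : (A : Matrix (Fin N) (Fin N) ℂ) ∈ tangentSpace K.topologicalClosure :=
    mem_tangentSpace_of_expSU_mem fun t => by simpa using hmem 0 t
  have hB : (B : Matrix (Fin N) (Fin N) ℂ) ∈ tangentSpace K.topologicalClosure := by
    have h := Submodule.sub_mem _ (mem_tangentSpace_of_expSU_mem (hmem 1)) hA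
    simpa using h
  have htop := eq_top_of_su_le_tangentSpace K.isClosed_topologicalClosure
    (hAB _ (fun X hX Y hY => lie_mem_tangentSpace hX hY) hA hB)
  rw [dense_iff_closure_eq, ← Subgroup.topologicalClosure_coe, htop]
  rfl

/-- By density some `r` in `S` is so close to `U * g⁻¹` that `r⁻¹ * U` lies in the given
neighbourhood of `g`; then `U = r * (r⁻¹ * U)`. -/
theorem eq_top_of_dense_of_mem_nhds {G : Type*} [Group G] [TopologicalSpace G]
    [IsTopologicalGroup G] {S : Submonoid G} (hS : Dense (S : Set G)) {g : G}
    (hg : (S : Set G) ∈ 𝓝 g) : S = ⊤ := by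
  refine (Submonoid.eq_top_iff' S).2 fun U => ?_
  have hc : Tendsto (fun x : G => x⁻¹ * U) (𝓝 (U * g⁻¹)) (𝓝 g) := by
    have : ContinuousAt (fun x : G => x⁻¹ * U) (U * g⁻¹) := by fun_prop
    simpa [ContinuousAt] using this
  obtain ⟨r, hr, hrS⟩ := hS.inter_nhds_nonempty (hc hg)
  simpa using S.mul_mem hr hrS

/-! ### Velocity spaces of families in the semigroup -/

/-- A real subspace of matrices that contains all conjugates of a diagonal drift with distinct
energy levels contains `𝔰𝔲(N)`. -/
theorem su_le_of_forall_conj_drift_mem {E : Fin N → ℝ} (hE : ∀ i j, i ≠ j → E j - E i ≠ 0)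
    {V : Submodule ℝ (Matrix (Fin N) (Fin N) ℂ)}
    (hV : ∀ p : Matrix.specialUnitaryGroup (Fin N) ℂ,
      (p : Matrix (Fin N) (Fin N) ℂ) * drift E * (p : Matrix (Fin N) (Fin N) ℂ)ᴴ ∈ V) :
    su N ≤ V := by
  -- `W` is the largest conjugation-invariant subspace of `V`. Differentiating the conjugation by
  -- `exp (s Y)` shows that it is stable under brackets with 𝔰𝔲(N).
  let W : Submodule ℝ (Matrix (Fin N) (Fin N) ℂ) :=
    { carrier := {X | ∀ p : Matrix.specialUnitaryGroup (Fin N) ℂ,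
        (p : Matrix (Fin N) (Fin N) ℂ) * X * (p : Matrix (Fin N) (Fin N) ℂ)ᴴ ∈ V}
      zero_mem' := fun p => by simp
      add_mem' := fun {X Y} hX hY p => by
        rw [mul_add, add_mul]
        exact V.add_mem (hX p) (hY p)
      smul_mem' := fun r X hX p => by
        rw [Matrix.mul_smul, Matrix.smul_mul]
        exact V.smul_mem r (hX p) }
  have hWV : W ≤ V := fun X hX => by simpa using hX 1
  refine le_trans (su_le_of_lie_su_mem hE (V := W) hV fun X hX Y hY => ?_) hWV
  have hmem : ⁅Y, X⁆ ∈ W := by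
    refine mem_of_hasDerivAt_of_forall_mem
      (hasDerivAt_conj hY.1 (hasDerivAt_exp_smul_zero Y) (by simp)) fun s p => ?_
    have h := hX (p * expSU (s • ⟨Y, hY⟩))
    simpa [Matrix.conjTranspose_mul, mul_assoc] using h
  have hneg : ⁅X, Y⁆ = -⁅Y, X⁆ := by
    rw [Ring.lie_def, Ring.lie_def, neg_sub]
  rw [hneg]
  exact W.neg_mem hmem

/-- `V` consists of velocities, translated to the identity, of a smooth family in `R`. -/
def IsVelocitySpace (R : Set (Matrix.specialUnitaryGroup (Fin N) ℂ))
    (g : Matrix.specialUnitaryGroup (Fin N) ℂ)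
    (V : Submodule ℝ (Matrix (Fin N) (Fin N) ℂ)) : Prop :=
  ∃ (P : Type) (_ : NormedAddCommGroup P) (_ : NormedSpace ℝ P) (_ : CompleteSpace P)
    (F : P → Matrix.specialUnitaryGroup (Fin N) ℂ) (F' : P →L[ℝ] Matrix (Fin N) (Fin N) ℂ),
    HasStrictFDerivAt (fun s => (F s : Matrix (Fin N) (Fin N) ℂ)) F' 0 ∧ F 0 = g ∧
      (∀ᶠ s in 𝓝 0, F s ∈ R) ∧ ∀ X ∈ V, ∃ s, F' s = X * (g : Matrix (Fin N) (Fin N) ℂ)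

theorem isVelocitySpace_bot {R : Set (Matrix.specialUnitaryGroup (Fin N) ℂ)}
    {g : Matrix.specialUnitaryGroup (Fin N) ℂ} (hg : g ∈ R) : IsVelocitySpace R g ⊥ := by
  refine ⟨ℝ, inferInstance, inferInstance, inferInstance, fun _ => g, 0,
    hasStrictFDerivAt_const _ _, rfl, Eventually.of_forall fun _ => hg, fun X hX => ⟨0, ?_⟩⟩
  rw [(Submodule.mem_bot ℝ).1 hX, zero_mul, map_zero]

/-- Appending a flow to a family adds its velocity to the velocity space. -/
theorem IsVelocitySpace.sup_span {R : Submonoid (Matrix.specialUnitaryGroup (Fin N) ℂ)}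
    {g h : Matrix.specialUnitaryGroup (Fin N) ℂ} {V : Submodule ℝ (Matrix (Fin N) (Fin N) ℂ)}
    (hV : IsVelocitySpace (R : Set (Matrix.specialUnitaryGroup (Fin N) ℂ)) g V) {A : su N}
    (hh : ∀ᶠ t : ℝ in 𝓝 0, h * expSU (t • A) ∈ R) :
    IsVelocitySpace (R : Set (Matrix.specialUnitaryGroup (Fin N) ℂ)) (g * h)
      (V ⊔ Submodule.span ℝ {((g * h : Matrix.specialUnitaryGroup (Fin N) ℂ) :
        Matrix (Fin N) (Fin N) ℂ) * A *
          ((g * h : Matrix.specialUnitaryGroup (Fin N) ℂ) : Matrix (Fin N) (Fin N) ℂ)ᴴ}) := by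
  obtain ⟨P, _, _, _, F, F', hF, hF0, hFR, hFV⟩ := hV
  have h1 : HasStrictFDerivAt (fun p : P × ℝ => (F p.1 : Matrix (Fin N) (Fin N) ℂ))
      (F'.comp (ContinuousLinearMap.fst ℝ P ℝ)) 0 :=
    HasStrictFDerivAt.comp (g := fun s => (F s : Matrix (Fin N) (Fin N) ℂ)) (0 : P × ℝ) hF
      hasStrictFDerivAt_fst
  have h2 : HasStrictFDerivAt (fun p : P × ℝ =>
      (h : Matrix (Fin N) (Fin N) ℂ) * exp (p.2 • (A : Matrix (Fin N) (Fin N) ℂ)))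
      ((ContinuousLinearMap.toSpanSingleton ℝ
        ((h : Matrix (Fin N) (Fin N) ℂ) * (A : Matrix (Fin N) (Fin N) ℂ))).comp
          (ContinuousLinearMap.snd ℝ P ℝ)) 0 := by
    have h3 : HasStrictDerivAt (fun t : ℝ => (h : Matrix (Fin N) (Fin N) ℂ) *
        exp (t • (A : Matrix (Fin N) (Fin N) ℂ)))
        ((h : Matrix (Fin N) (Fin N) ℂ) * (A : Matrix (Fin N) (Fin N) ℂ)) 0 := by
      simpa using (hasStrictDerivAt_exp_smul_const (A : Matrix (Fin N) (Fin N) ℂ)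
        (0 : ℝ)).const_mul (h : Matrix (Fin N) (Fin N) ℂ)
    exact HasStrictFDerivAt.comp (g := fun t : ℝ => (h : Matrix (Fin N) (Fin N) ℂ) *
      exp (t • (A : Matrix (Fin N) (Fin N) ℂ))) (0 : P × ℝ) h3.hasStrictFDerivAt
      hasStrictFDerivAt_snd
  refine ⟨P × ℝ, inferInstance, inferInstance, inferInstance,
    fun p => F p.1 * (h * expSU (p.2 • A)), _, h1.mul' h2, ?_, ?_, ?_⟩
  · simp [hF0, expSU_zero]
  · filter_upwards [prod_mem_nhds hFR hh] with p hp
    exact R.mul_mem hp.1 hp.2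
  · intro X hX
    obtain ⟨Y, hY, Z, hZ, rfl⟩ := Submodule.mem_sup.1 hX
    obtain ⟨r, rfl⟩ := Submodule.mem_span_singleton.1 hZ
    obtain ⟨s, hs⟩ := hFV Y hY
    refine ⟨(s, r), ?_⟩
    have hleft : ((g : Matrix (Fin N) (Fin N) ℂ))ᴴ * ((g : Matrix (Fin N) (Fin N) ℂ) * h) = h := by
      rw [← mul_assoc, conjTranspose_mul_coe, one_mul]
    simp [hF0, hs, add_mul, mul_assoc, hleft, conjTranspose_mul_coe, add_comm]

/-- If `R` is dense, a maximal velocity space contains `𝔰𝔲(N)`. -/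
theorem exists_isVelocitySpace_su {R : Submonoid (Matrix.specialUnitaryGroup (Fin N) ℂ)}
    (hR : Dense (R : Set (Matrix.specialUnitaryGroup (Fin N) ℂ))) {E : Fin N → ℝ}
    (hE : ∀ i j, i ≠ j → E j - E i ≠ 0) (hsu : drift E ∈ su N)
    (hER : ∀ t : ℝ, 0 ≤ t → expSU (t • ⟨drift E, hsu⟩) ∈ R) :
    ∃ g, IsVelocitySpace (R : Set (Matrix.specialUnitaryGroup (Fin N) ℂ)) g (su N) := by
  obtain ⟨V, ⟨g, hg⟩, hmax⟩ := (wellFounded_gt (α := Submodule ℝ (Matrix (Fin N) (Fin N) ℂ))).has_min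
    {V | ∃ g, IsVelocitySpace (R : Set (Matrix.specialUnitaryGroup (Fin N) ℂ)) g V}
    ⟨⊥, 1, isVelocitySpace_bot R.one_mem⟩
  set A : su N := ⟨drift E, hsu⟩ with hA
  -- The factor `exp A` leaves room for small negative times: `exp A * exp (t A)` is a positive-time
  -- flow for `t > -1`, so `t` ranges over a neighbourhood of `0`.
  set φ : Matrix.specialUnitaryGroup (Fin N) ℂ → Matrix.specialUnitaryGroup (Fin N) ℂ :=
    fun h => g * (h * expSU A) with hφ
  have hφR : ∀ h ∈ R, (φ h : Matrix (Fin N) (Fin N) ℂ) * A *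
      (φ h : Matrix (Fin N) (Fin N) ℂ)ᴴ ∈ V := by
    intro h hh
    have hev : ∀ᶠ t : ℝ in 𝓝 0, h * expSU A * expSU (t • A) ∈ R := by
      filter_upwards [Ioi_mem_nhds (show (-1 : ℝ) < 0 by norm_num)] with t ht
      have h1 : expSU A = expSU ((1 : ℝ) • A) := by rw [one_smul]
      rw [mul_assoc, h1, ← expSU_add_smul]
      exact R.mul_mem hh (hER _ (by linarith [Set.mem_Ioi.1 ht]))
    have hsup := hg.sup_span hev
    -- Maximality of `V`: the enlarged velocity space cannot be strictly larger.
    have hle := not_lt_iff_le_imp_ge.1 (hmax _ ⟨_, hsup⟩) le_sup_left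
    exact hle (Submodule.mem_sup_right (Submodule.mem_span_singleton_self _))
  have hclosed : IsClosed {p : Matrix.specialUnitaryGroup (Fin N) ℂ |
      (p : Matrix (Fin N) (Fin N) ℂ) * A * (p : Matrix (Fin N) (Fin N) ℂ)ᴴ ∈ V} := by
    have hVc : IsClosed (V : Set (Matrix (Fin N) (Fin N) ℂ)) := V.closed_of_finiteDimensional
    refine hVc.preimage (f := fun p : Matrix.specialUnitaryGroup (Fin N) ℂ =>
      (p : Matrix (Fin N) (Fin N) ℂ) * A * (p : Matrix (Fin N) (Fin N) ℂ)ᴴ) ?_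
    exact (continuous_subtype_val.mul continuous_const).mul
      (continuous_star.comp continuous_subtype_val)
  have hall : ∀ p : Matrix.specialUnitaryGroup (Fin N) ℂ,
      (p : Matrix (Fin N) (Fin N) ℂ) * A * (p : Matrix (Fin N) (Fin N) ℂ)ᴴ ∈ V := by
    intro p
    have hφc : Continuous φ := by fun_prop
    have hmem : ∀ h, h ∈ φ ⁻¹' {p : Matrix.specialUnitaryGroup (Fin N) ℂ |
        (p : Matrix (Fin N) (Fin N) ℂ) * A * (p : Matrix (Fin N) (Fin N) ℂ)ᴴ ∈ V} := fun h =>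
      (hclosed.preimage hφc).closure_subset_iff.2 hφR (hR h)
    have h := hmem (g⁻¹ * p * (expSU A)⁻¹)
    have heq : φ (g⁻¹ * p * (expSU A)⁻¹) = p := by
      simp [hφ, mul_assoc]
    rwa [Set.mem_preimage, heq] at h
  have hle := su_le_of_forall_conj_drift_mem hE hall
  obtain ⟨P, i1, i2, i3, F, F', hF, hF0, hFR, hFV⟩ := hg
  exact ⟨g, P, i1, i2, i3, F, F', hF, hF0, hFR, fun X hX => hFV X (hle hX)⟩

/-! ### From velocities to a neighbourhood -/

theorem eq_zero_of_exp_eq_one {H : Matrix (Fin N) (Fin N) ℂ} (hH : H.IsHermitian)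
    (h : exp H = 1) : H = 0 := by
  have h1 := CFC.log_exp H hH
  have h2 := CFC.log_exp (0 : Matrix (Fin N) (Fin N) ℂ) (.zero _)
  rw [exp_zero] at h2
  rw [← h1, h, h2]

/-- The exponential of a small element of the complement `{H + i τ}` of `𝔰𝔲(N)` lies in `SU(N)`
only if it is the identity. -/
theorem exp_eq_one_of_mem_specialUnitaryGroup {H : Matrix (Fin N) (Fin N) ℂ} (hH : H.IsHermitian)
    {τ : ℝ} (hτ : |τ * N| < 2 * Real.pi)
    (h : exp (H + (Complex.I * τ) • (1 : Matrix (Fin N) (Fin N) ℂ)) ∈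
      Matrix.specialUnitaryGroup (Fin N) ℂ) :
    exp (H + (Complex.I * τ) • (1 : Matrix (Fin N) (Fin N) ℂ)) = 1 := by
  obtain ⟨hu, hdet⟩ := Matrix.mem_specialUnitaryGroup_iff.1 h
  rw [Matrix.mem_unitaryGroup_iff, Matrix.star_eq_conjTranspose, ← Matrix.exp_conjTranspose,
    Matrix.conjTranspose_add, hH.eq, Matrix.conjTranspose_smul, Matrix.conjTranspose_one,
    ← Matrix.exp_add_of_commute] at hu
  · have hstar : star (Complex.I * τ) = -(Complex.I * τ) := by simp
    rw [hstar, neg_smul, add_add_add_comm, add_neg_cancel, add_zero] at hu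
    -- Unitarity reads `exp (2H) = 1`, which forces `H = 0`. The determinant then reads `exp (i τ N)
    -- = 1`, and the bound on `τ` excludes all nonzero multiples of `2π`.
    have h2 : H + H = 0 := eq_zero_of_exp_eq_one (hH.add hH) hu
    have h0 : H = 0 := by
      rw [← two_smul ℝ] at h2
      exact (smul_eq_zero.1 h2).resolve_left two_ne_zero
    rw [h0, zero_add] at hdet ⊢
    have hherm : ((τ : ℂ) • (1 : Matrix (Fin N) (Fin N) ℂ)).IsHermitian := by
      rw [Matrix.IsHermitian, Matrix.conjTranspose_smul]
      simp
    rw [← smul_smul, det_exp_I_smul hherm, Complex.exp_eq_one_iff] at hdet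
    obtain ⟨n, hn⟩ := hdet
    rw [Matrix.trace_smul, Matrix.trace_one, Fintype.card_fin, smul_eq_mul] at hn
    have hn' : τ * N = n * (2 * Real.pi) := by
      have : Complex.I * (τ * N) = Complex.I * (n * (2 * Real.pi)) := by
        rw [hn]
        ring
      exact_mod_cast mul_left_cancel₀ Complex.I_ne_zero this
    have hπ : (0 : ℝ) < 2 * Real.pi := by positivity
    have hn0 : n = 0 := by
      rw [hn', abs_mul, abs_of_pos hπ, mul_lt_iff_lt_one_left hπ] at hτ
      exact Int.abs_lt_one_iff.1 (by exact_mod_cast hτ)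
    rw [hn0, Int.cast_zero, zero_mul, mul_eq_zero] at hn'
    rcases hn' with h | h
    · simp [h]
    · have : N = 0 := by exact_mod_cast h
      subst this
      exact Subsingleton.elim _ _
  · refine Commute.add_left (Commute.add_right (Commute.refl _) ?_) ?_
    · exact (Commute.one_right _).smul_right _
    · exact (Commute.one_left _).smul_left _

/-- The parametrization `(Y, τ) ↦ Y + Yᴴ + i τ` of a complement of `𝔰𝔲(N)`. -/
noncomputable def complementMap (N : ℕ) :
    (Matrix (Fin N) (Fin N) ℂ × ℝ) →L[ℝ] Matrix (Fin N) (Fin N) ℂ :=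
  LinearMap.toContinuousLinearMap
    { toFun := fun p => (p.1 + p.1ᴴ) + (Complex.I * p.2) • (1 : Matrix (Fin N) (Fin N) ℂ)
      map_add' := fun p q => by
        simp only [Prod.fst_add, Prod.snd_add, Matrix.conjTranspose_add, Complex.ofReal_add,
          mul_add, add_smul]
        abel
      map_smul' := fun r p => by
        simp only [Prod.smul_fst, Prod.smul_snd, Matrix.conjTranspose_smul, smul_add, smul_eq_mul,
          Complex.ofReal_mul, RingHom.id_apply, star_trivial]
        rw [← smul_assoc, Complex.real_smul, mul_left_comm] }

theorem complementMap_apply (p : Matrix (Fin N) (Fin N) ℂ × ℝ) :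
    complementMap N p = (p.1 + p.1ᴴ) + (Complex.I * p.2) • (1 : Matrix (Fin N) (Fin N) ℂ) :=
  rfl

/-- Split `W` into its Hermitian part and its skew-Hermitian part `K`, and split off from `K` the
imaginary scalar that carries its trace. -/
theorem exists_complementMap_add_eq [NeZero N] (W : Matrix (Fin N) (Fin N) ℂ) :
    ∃ p, ∃ X ∈ su N, complementMap N p + X = W := by
  obtain ⟨K, hK⟩ : ∃ K : Matrix (Fin N) (Fin N) ℂ, K = (2⁻¹ : ℝ) • (W - Wᴴ) := ⟨_, rfl⟩
  have hKs : Kᴴ = -K := by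
    rw [hK, Matrix.conjTranspose_smul, Matrix.conjTranspose_sub, Matrix.conjTranspose_conjTranspose,
      star_trivial, ← smul_neg, neg_sub]
  have hN : (N : ℂ) ≠ 0 := Nat.cast_ne_zero.2 (NeZero.ne N)
  have htr : K.trace = Complex.I * (K.trace.im : ℝ) := by
    have h := congrArg Matrix.trace hKs
    rw [Matrix.trace_conjTranspose, Matrix.trace_neg] at h
    have hre := congrArg Complex.re h
    simp only [Complex.star_def, Complex.conj_re, Complex.neg_re] at hre
    apply Complex.ext
    · simp
      linarith
    · simp
  refine ⟨((4⁻¹ : ℝ) • (W + Wᴴ), K.trace.im / N),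
    K - (Complex.I * (K.trace.im / N : ℝ)) • (1 : Matrix (Fin N) (Fin N) ℂ), ⟨?_, ?_⟩, ?_⟩
  · rw [Matrix.conjTranspose_sub, hKs, Matrix.conjTranspose_smul, Matrix.conjTranspose_one]
    have : star (Complex.I * (K.trace.im / N : ℝ)) = -(Complex.I * (K.trace.im / N : ℝ)) := by
      rw [star_mul', Complex.star_def, Complex.conj_I, Complex.conj_ofReal, neg_mul]
    rw [this, neg_smul]
    abel
  · rw [Matrix.trace_sub, Matrix.trace_smul, Matrix.trace_one, Fintype.card_fin, smul_eq_mul]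
    have hdiv : ((K.trace.im / N : ℝ) : ℂ) * N = K.trace.im := by
      push_cast
      field_simp
    linear_combination htr - Complex.I * hdiv
  · rw [complementMap_apply]
    simp only [Matrix.conjTranspose_smul, Matrix.conjTranspose_add, star_trivial,
      Matrix.conjTranspose_conjTranspose]
    rw [add_assoc, add_sub_cancel, hK]
    module

/-- A set that has `𝔰𝔲(N)` as a velocity space at `g` is a neighbourhood of `g`. -/
theorem IsVelocitySpace.mem_nhds [NeZero N] {R : Set (Matrix.specialUnitaryGroup (Fin N) ℂ)}
    {g : Matrix.specialUnitaryGroup (Fin N) ℂ} (h : IsVelocitySpace R g (su N)) : R ∈ 𝓝 g := by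
  obtain ⟨P, _, _, _, F, F', hF, hF0, hFR, hFV⟩ := h
  -- SU(N) is not open in the matrices, so the family is thickened by the complement of 𝔰𝔲(N). The
  -- derivative of `Φ` at `0` is then onto all matrices and `Φ` is open there.
  set Φ : (Matrix (Fin N) (Fin N) ℂ × ℝ) × P → Matrix (Fin N) (Fin N) ℂ :=
    fun x => exp (complementMap N x.1) * F x.2 with hΦ
  have h1 : HasStrictFDerivAt (fun x : (Matrix (Fin N) (Fin N) ℂ × ℝ) × P =>
      exp (complementMap N x.1))
      ((1 : Matrix (Fin N) (Fin N) ℂ →L[ℝ] Matrix (Fin N) (Fin N) ℂ).comp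
        ((complementMap N).comp (ContinuousLinearMap.fst ℝ _ P))) 0 := by
    refine HasStrictFDerivAt.comp (g := exp) 0 ?_
      ((complementMap N).comp (ContinuousLinearMap.fst ℝ _ P)).hasStrictFDerivAt
    have h0 : complementMap N (0 : (Matrix (Fin N) (Fin N) ℂ × ℝ) × P).1 = 0 := by simp
    simp only [h0]
    exact hasStrictFDerivAt_exp_zero
  have h2 : HasStrictFDerivAt (fun x : (Matrix (Fin N) (Fin N) ℂ × ℝ) × P =>
      (F x.2 : Matrix (Fin N) (Fin N) ℂ))
      (F'.comp (ContinuousLinearMap.snd ℝ (Matrix (Fin N) (Fin N) ℂ × ℝ) P)) 0 :=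
    HasStrictFDerivAt.comp (g := fun s => (F s : Matrix (Fin N) (Fin N) ℂ)) 0 hF
      hasStrictFDerivAt_snd
  have hΦ0 : Φ 0 = g := by
    simp [hΦ, hF0]
  have hmap := (h1.mul' h2).map_nhds_eq_of_surj (by
    refine LinearMap.range_eq_top.2 fun Z => ?_
    obtain ⟨p, X, hX, hpX⟩ := exists_complementMap_add_eq (Z * (g : Matrix (Fin N) (Fin N) ℂ)ᴴ)
    obtain ⟨s, hs⟩ := hFV X hX
    refine ⟨(p, s), ?_⟩
    have : (complementMap N p + X) * g = Z := by
      rw [hpX, mul_assoc, conjTranspose_mul_coe, mul_one]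
    simp [hF0, hs, ← this, add_mul, add_comm])
  change map Φ (𝓝 0) = 𝓝 (Φ 0) at hmap
  rw [hΦ0] at hmap
  have hτ : ∀ᶠ x : (Matrix (Fin N) (Fin N) ℂ × ℝ) × P in 𝓝 0, |x.1.2 * N| < 2 * Real.pi := by
    have hc : Continuous fun x : (Matrix (Fin N) (Fin N) ℂ × ℝ) × P => |x.1.2 * N| := by fun_prop
    refine hc.continuousAt.eventually_lt continuousAt_const ?_
    simpa using Real.pi_pos
  have hR : ∀ᶠ x : (Matrix (Fin N) (Fin N) ℂ × ℝ) × P in 𝓝 0, F x.2 ∈ R :=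
    (continuous_snd.tendsto (0 : (Matrix (Fin N) (Fin N) ℂ × ℝ) × P)).eventually hFR
  have himg := image_mem_map (m := Φ) (hτ.and hR)
  rw [hmap] at himg
  filter_upwards [continuous_subtype_val.continuousAt.preimage_mem_nhds himg] with U hU
  obtain ⟨⟨⟨Y, τ⟩, s⟩, ⟨hx1, hx2⟩, hxU⟩ := hU
  -- For a value `U` of `Φ` in SU(N) the transversal factor is `U * (F s)⁻¹`, hence in SU(N), hence
  -- `1`. So `U = F s` belongs to `R`.
  have hexp : exp (complementMap N (Y, τ)) =
      ((U * (F s)⁻¹ : Matrix.specialUnitaryGroup (Fin N) ℂ) : Matrix (Fin N) (Fin N) ℂ) := by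
    rw [Submonoid.coe_mul, ← hxU, coe_inv_specialUnitaryGroup, hΦ, mul_assoc,
      coe_mul_conjTranspose, mul_one]
  have hone := exp_eq_one_of_mem_specialUnitaryGroup (H := Y + Yᴴ) (τ := τ)
    (Matrix.isHermitian_add_transpose_self Y) hx1 (by
      rw [complementMap_apply] at hexp
      rw [hexp]
      exact Subtype.property _)
  have hUF : U = F s := by
    ext1
    rw [← hxU, hΦ]
    simp only [complementMap_apply, hone, one_mul]
  rw [hUF]
  exact hx2

/-! ### Concatenation of trajectories -/

theorem one_mem_reachableSet (A B : Matrix (Fin N) (Fin N) ℂ) : 1 ∈ reachableSet A B := by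
  refine ⟨0, le_rfl, fun _ => 0, fun _ => 1, ⟨continuousOn_const, fun _ _ => one_mem _, rfl, ∅, ?_⟩,
    rfl⟩
  intro t ht
  exact absurd (ht.1.trans ht.2) (lt_irrefl _)

/-- A trajectory is continued by a constant input. -/
theorem expSU_mul_mem_reachableSet (A B : su N) {τ : ℝ} (hτ : 0 ≤ τ) (c : ℝ)
    {Y : Matrix.specialUnitaryGroup (Fin N) ℂ}
    (hY : Y ∈ reachableSet (A : Matrix (Fin N) (Fin N) ℂ) B) :
    expSU (τ • (A + c • B)) * Y ∈ reachableSet (A : Matrix (Fin N) (Fin N) ℂ) B := by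
  obtain ⟨T, hT, u, X, ⟨hXc, hXsu, hX0, S, hS⟩, hXT⟩ := hY
  set γ : ℝ → Matrix (Fin N) (Fin N) ℂ := fun t =>
    ((expSU ((t - T) • (A + c • B)) * Y : Matrix.specialUnitaryGroup (Fin N) ℂ) :
      Matrix (Fin N) (Fin N) ℂ) with hγ
  have hγT : γ T = X T := by
    simp [hγ, hXT]
  have hγ' (t : ℝ) : HasDerivAt γ ((A + c • B) * γ t) t := by
    have h1 := hasDerivAt_exp_smul_const'
      ((A : Matrix (Fin N) (Fin N) ℂ) + c • (B : Matrix (Fin N) (Fin N) ℂ)) (t - T)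
    have h2 := (h1.comp_sub_const t T).mul_const (Y : Matrix (Fin N) (Fin N) ℂ)
    rw [mul_assoc] at h2
    exact h2
  have hγc : Continuous γ := continuous_iff_continuousAt.2 fun t => (hγ' t).continuousAt
  set X' : ℝ → Matrix (Fin N) (Fin N) ℂ := fun t => if t ≤ T then X t else γ t with hX'
  have hleft : Set.EqOn X' X (Set.Icc 0 T) := fun t ht => if_pos ht.2
  have hright : Set.EqOn X' γ (Set.Icc T (T + τ)) := by
    intro t ht
    rcases ht.1.eq_or_lt with rfl | h
    · simp only [hX', le_refl, if_true, hγT]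
    · exact if_neg (not_le.2 h)
  refine ⟨T + τ, add_nonneg hT hτ, fun t => if t ≤ T then u t else c, X',
    -- The junction `T` becomes a switching time: the input may jump there.
    ⟨?_, ?_, ?_, insert T S, ?_⟩, ?_⟩
  · rw [← Set.Icc_union_Icc_eq_Icc hT (le_add_of_nonneg_right hτ)]
    exact (hXc.congr hleft).union_of_isClosed (hγc.continuousOn.congr hright) isClosed_Icc
      isClosed_Icc
  · intro t ht
    rcases le_total t T with h | h
    · rw [hleft ⟨ht.1, h⟩]
      exact hXsu t ⟨ht.1, h⟩
    · rw [hright ⟨h, ht.2⟩]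
      exact Subtype.property _
  · rw [hleft ⟨le_rfl, hT⟩, hX0]
  · intro t ht htS
    rw [Finset.mem_insert, not_or] at htS
    rcases lt_or_gt_of_ne htS.1 with h | h
    · obtain ⟨hu, hd⟩ := hS t ⟨ht.1, h⟩ htS.2
      have hev : ∀ᶠ s in 𝓝 t, s < T := Iio_mem_nhds h
      refine ⟨?_, ?_⟩
      · filter_upwards [hev, hu] with s hs hus
        simp only [if_pos hs.le, if_pos h.le, hus]
      · simp only [if_pos h.le, hX']
        refine hd.congr_of_eventuallyEq ?_
        filter_upwards [hev] with s hs
        exact if_pos hs.le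
    · have hev : ∀ᶠ s in 𝓝 t, T < s := Ioi_mem_nhds h
      refine ⟨?_, ?_⟩
      · filter_upwards [hev] with s hs
        simp only [if_neg (not_le.2 hs), if_neg (not_le.2 h)]
      · simp only [if_neg (not_le.2 h), hX']
        refine (hγ' t).congr_of_eventuallyEq ?_
        filter_upwards [hev] with s hs
        exact if_neg (not_le.2 hs)
  · rw [hright ⟨le_add_of_nonneg_right hτ, le_rfl⟩]
    simp only [hγ, add_sub_cancel_left]

theorem flowMonoid_subset_reachableSet (A B : su N) :
    (flowMonoid A B : Set (Matrix.specialUnitaryGroup (Fin N) ℂ)) ⊆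
      reachableSet (A : Matrix (Fin N) (Fin N) ℂ) B := by
  intro g hg
  refine Submonoid.closure_induction_left (one_mem_reachableSet _ _) ?_ hg
  rintro _ ⟨t, ht, u, rfl⟩ y - hy
  exact expSU_mul_mem_reachableSet A B ht u hy

theorem drift_mem_su {E : Fin N → ℝ} (hE : ∑ i, E i = 0) : drift E ∈ su N := by
  refine ⟨?_, ?_⟩
  · rw [drift, Matrix.diagonal_conjTranspose, Matrix.diagonal_neg]
    congr 1
    ext j
    simp
  · rw [drift, Matrix.trace_diagonal, ← Finset.mul_sum]
    have : ∑ i, (E i : ℂ) = 0 := by exact_mod_cast hE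
    rw [this, mul_zero]

end QuantumControl

/-! ### Controllability -/

theorem mainTheorem2 (N : ℕ) (E : Fin N → ℝ) (hE : ∑ i, E i = 0)
    (B : Matrix (Fin N) (Fin N) ℂ) (hB : B ∈ QuantumControl.su N)
    (hconn : QuantumControl.GraphConnected B) (hreg : QuantumControl.IsRegularDrift E) :
    QuantumControl.Controllable (QuantumControl.drift E) B := by
  have hN : NeZero N := by
    obtain ⟨i⟩ := hconn.nonempty
    exact ⟨(Nat.zero_le _).trans_lt i.2 |>.ne'⟩
  set A : QuantumControl.su N := ⟨QuantumControl.drift E, QuantumControl.drift_mem_su hE⟩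
  have hdense := QuantumControl.dense_flowMonoid A ⟨B, hB⟩ fun V hV hA hBV =>
    QuantumControl.su_le_of_regular_of_connected hreg hB.1 hconn hV hA hBV
  obtain ⟨g, hg⟩ := QuantumControl.exists_isVelocitySpace_su hdense hreg.1
    (QuantumControl.drift_mem_su hE) fun t ht =>
      QuantumControl.expSU_drift_mem_flowMonoid A ⟨B, hB⟩ ht
  have htop := QuantumControl.eq_top_of_dense_of_mem_nhds hdense hg.mem_nhds
  refine Set.eq_univ_of_forall fun U => ?_
  exact QuantumControl.flowMonoid_subset_reachableSet A ⟨B, hB⟩ (htop ▸ Submonoid.mem_top U)
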